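/- Let $G$ be a finite group, $k$ a field, and let $W\neq 0$ be a finite-dimensional $kG$-module; all modules are finite-dimensional, $\otimes=\otimes_k$ with diagonal action, and $^*$ is the $k$-dual. A module is *$W$-projective* if it is a direct summand of $W^*\otimes Y$ for some module $Y$. The *$W$-stable category* has the $kG$-modules as objects and, as morphisms $(X,Y)_W$, the $kG$-homomorphisms modulo those that factor through a $W$-projective module. For a module $V$ let $\Omega_V(X)$ be the kernel of the evaluation map $V^*\otimes V\otimes X\to X$ and $\Omega_V^{-1}(X)$ the cokernel of the coevaluation map $X\to V^*\otimes V\otimes X$; both induce endofunctors of the $W$-stable category. The shift of the $W$-stable category is $\Omega_W^{-1}$ (with inverse $\Omega_W$), and its distinguished triangles are those isomorphic to the triangles $X_1\to X_2\to X_3\to\Omega_W^{-1}X_1$ that come from short exact sequences $0\to X_1\to X_2\to X_3\to 0$ which split after applying $W\otimes -$. A *thick subcategory* is a full subcategory, closed under isomorphism, that contains zero, is closed under the shift and its inverse, under direct summands, and contains the third object of a distinguished triangle whenever it contains two of them. A module $X$ is *virtually $W$-projective* if for every module $Y$ the transfer map $$\mathrm{Tr}_W:\mathrm{Ext}^n_{kG}(W\otimes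 X,W\otimes Y)\to \mathrm{Ext}^n_{kG}(X,W^*\otimes W\otimes Y)\to\mathrm{Ext}^n_{kG}(X,Y)$$ (the adjunction isomorphism followed by evaluation) is surjective for all sufficiently large $n$. For an endofunctor $F$ of the $W$-stable category, put $$\mathcal L_F=\{X : \text{for all } Y,\ (F^nX,Y)_W=0 \text{ for all sufficiently large } n\}.$$ Then: 1. A module $X$ is virtually $W$-projective if and only if $X\in\mathcal L_{\Omega_{kG}}$, i.e. for every module $Y$ one has $(\Omega_{kG}^n X,Y)_W=0$ for all sufficiently large $n$. 2. The virtually $W$-projective modules form a thick subcategory of the $W$-stable category. 3. For every $W$-projective module $V$, the class $\mathcal L(V)=\mathcal L_{\Omega_V}$ is a thick subcategory of the $W$-stable category. -/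

import Mathlib

open CategoryTheory Limits MonoidalCategory

universe w v u

set_option linter.unusedSectionVars false

noncomputable section

namespace RelStable

/-! ### Relative projectivity in a symmetric rigid abelian category

The constructions are written for an abelian category with an additive symmetric monoidal structure
in which every object has a dual; the case of interest is the category `FDRep k G` of finite
dimensional representations of a finite group `G` over a field `k`, with the diagonal action on the
tensor product over `k`. -/

section General

variable {C : Type u} [Category.{v} C] [Abelian C] [MonoidalCategory C] [MonoidalPreadditive C]
  [SymmetricCategory C] [RightRigidCategory C]

/-- The counit `W* ⊗ (W ⊗ X) ⟶ X` of the adjunction `W* ⊗ - ⊣ W ⊗ -`, given by evaluation. -/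
def counit (W X : C) : Wᘁ ⊗ (W ⊗ X) ⟶ X :=
  (α_ Wᘁ W X).inv ≫ (ε_ W Wᘁ) ▷ X ≫ (λ_ X).hom

/-- The unit `X ⟶ W* ⊗ (W ⊗ X)` of the adjunction `W ⊗ - ⊣ W* ⊗ -`, given by coevaluation. -/
def unit (W X : C) : X ⟶ Wᘁ ⊗ (W ⊗ X) :=
  (λ_ X).inv ≫ (η_ W Wᘁ ≫ (β_ W Wᘁ).hom) ▷ X ≫ (α_ Wᘁ W X).hom

lemma counit_naturality (W : C) {X Y : C} (f : X ⟶ Y) :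
    (Wᘁ ◁ (W ◁ f)) ≫ counit W Y = counit W X ≫ f := by
  have h := (whisker_exchange (ε_ W Wᘁ) f)
  simp only [counit, Category.assoc, ← leftUnitor_naturality, ← reassoc_of% h]
  simp

lemma unit_naturality (W : C) {X Y : C} (f : X ⟶ Y) :
    f ≫ unit W Y = unit W X ≫ (Wᘁ ◁ (W ◁ f)) := by
  have h := (whisker_exchange (η_ W Wᘁ ≫ (β_ W Wᘁ).hom) f)
  simp only [unit, Category.assoc, leftUnitor_inv_naturality_assoc, reassoc_of% h]
  simp

/-- The Heller translate `Ω_V X = ker (V* ⊗ V ⊗ X ⟶ X)`, as an endofunctor. -/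
def omega (V : C) : C ⥤ C where
  obj X := kernel (counit V X)
  map {X Y} f := kernel.map (counit V X) (counit V Y) (Vᘁ ◁ (V ◁ f)) f (counit_naturality V f).symm

/-- The inverse translate `Ω_V⁻¹ X = coker (X ⟶ V* ⊗ V ⊗ X)`, as an endofunctor. -/
def omegaInv (V : C) : C ⥤ C where
  obj X := cokernel (unit V X)
  map {X Y} f := cokernel.map (unit V X) (unit V Y) f (Vᘁ ◁ (V ◁ f)) (unit_naturality V f).symm

/-- `P` is `W`-projective: a direct summand of an object `W* ⊗ Y` in the image of the left adjoint
of `W ⊗ -`. -/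
def IsRelProjective (W P : C) : Prop :=
  ∃ Y : C, Nonempty (Retract P (Wᘁ ⊗ Y))

/-- `f` factors through a `W`-projective object. -/
def FactorsThroughProjective (W : C) {X Y : C} (f : X ⟶ Y) : Prop :=
  ∃ (P : C) (a : X ⟶ P) (b : P ⟶ Y), IsRelProjective W P ∧ a ≫ b = f

/-- Two morphisms are identified when their difference factors through a `W`-projective object. -/
def stableRel (W : C) : HomRel C := fun _ _ f g => FactorsThroughProjective W (f - g)

lemma FactorsThroughProjective.comp_left {W X Y Z : C} (a : X ⟶ Y) {f : Y ⟶ Z}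
    (h : FactorsThroughProjective W f) : FactorsThroughProjective W (a ≫ f) := by
  obtain ⟨P, b, c, hP, rfl⟩ := h
  exact ⟨P, a ≫ b, c, hP, by simp⟩

lemma FactorsThroughProjective.comp_right {W X Y Z : C} {f : X ⟶ Y}
    (h : FactorsThroughProjective W f) (a : Y ⟶ Z) : FactorsThroughProjective W (f ≫ a) := by
  obtain ⟨P, b, c, hP, rfl⟩ := h
  exact ⟨P, b, c ≫ a, hP, by simp⟩

lemma FactorsThroughProjective.exists_tensor {W X Y : C} {f : X ⟶ Y}
    (h : FactorsThroughProjective W f) :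
    ∃ (Q : C) (a : X ⟶ Wᘁ ⊗ Q) (b : Wᘁ ⊗ Q ⟶ Y), a ≫ b = f := by
  obtain ⟨P, a, b, ⟨Q, ⟨r⟩⟩, rfl⟩ := h
  exact ⟨Q, a ≫ r.i, r.r ≫ b, by simp⟩

lemma isRelProjective_tensor (W Q : C) : IsRelProjective W (Wᘁ ⊗ Q) := ⟨Q, ⟨Retract.refl _⟩⟩

lemma FactorsThroughProjective.zero (W X Y : C) :
    FactorsThroughProjective W (0 : X ⟶ Y) :=
  ⟨Wᘁ ⊗ X, 0, 0, isRelProjective_tensor W X, by simp⟩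

lemma FactorsThroughProjective.neg {W X Y : C} {f : X ⟶ Y}
    (h : FactorsThroughProjective W f) : FactorsThroughProjective W (-f) := by
  obtain ⟨P, b, c, hP, rfl⟩ := h
  exact ⟨P, b, -c, hP, by simp⟩

lemma FactorsThroughProjective.add {W X Y : C} {f g : X ⟶ Y}
    (hf : FactorsThroughProjective W f) (hg : FactorsThroughProjective W g) :
    FactorsThroughProjective W (f + g) := by
  obtain ⟨P, a, b, rfl⟩ := hf.exists_tensor
  obtain ⟨Q, c, d, rfl⟩ := hg.exists_tensor
  refine ⟨Wᘁ ⊗ (P ⊞ Q), a ≫ (Wᘁ ◁ biprod.inl) + c ≫ (Wᘁ ◁ biprod.inr),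
    (Wᘁ ◁ biprod.fst) ≫ b + (Wᘁ ◁ biprod.snd) ≫ d, isRelProjective_tensor _ _, ?_⟩
  simp [← MonoidalCategory.whiskerLeft_comp_assoc]

instance (W : C) : Congruence (stableRel W) where
  equivalence :=
    { refl := fun f => by
        simpa [stableRel] using FactorsThroughProjective.zero W _ _
      symm := fun {f g} h => by
        simpa [stableRel] using FactorsThroughProjective.neg h
      trans := fun {f g h} h₁ h₂ => by
        simpa [stableRel] using FactorsThroughProjective.add h₁ h₂ }
  comp_left f g g' h := by
    simpa [stableRel] using FactorsThroughProjective.comp_left f h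
  comp_right g h := by
    simpa [stableRel] using FactorsThroughProjective.comp_right h g

/-- The `W`-stable category: the objects are those of `C`, the morphisms are those of `C` modulo
morphisms factoring through `W`-projective objects. -/
abbrev StableCat (W : C) := CategoryTheory.Quotient (stableRel W)

instance (W : C) : Preadditive (StableCat W) :=
  CategoryTheory.Quotient.preadditive (stableRel W) fun _ _ f₁ f₂ g₁ g₂ hf hg => by
    have := FactorsThroughProjective.add hf hg
    rwa [sub_add_sub_comm] at this

/-- The projection to the `W`-stable category. -/
abbrev toStable (W : C) : C ⥤ StableCat W := CategoryTheory.Quotient.functor (stableRel W)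

/-! Facts needed for `Ω_V` and `Ω_V⁻¹` to descend to the `W`-stable category. -/

instance tensorLeft_isRightAdjoint (Z : C) : (tensorLeft Z).IsRightAdjoint :=
  (tensorLeftAdjunction Z Zᘁ).isRightAdjoint

instance tensorLeft_isLeftAdjoint (Z : C) : (tensorLeft Z).IsLeftAdjoint :=
  letI := BraidedCategory.exactPairing_swap Z Zᘁ
  (tensorLeftAdjunction Zᘁ Z).isLeftAdjoint

instance tensorRight_isLeftAdjoint (Z : C) : (tensorRight Z).IsLeftAdjoint :=
  (tensorRightAdjunction Z Zᘁ).isLeftAdjoint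

instance tensorRight_isRightAdjoint (Z : C) : (tensorRight Z).IsRightAdjoint :=
  letI := BraidedCategory.exactPairing_swap Z Zᘁ
  (tensorRightAdjunction Zᘁ Z).isRightAdjoint

instance tensorLeft_preservesFiniteLimits (Z : C) : PreservesFiniteLimits (tensorLeft Z) :=
  have := (Adjunction.ofIsRightAdjoint (tensorLeft Z)).rightAdjoint_preservesLimits
  inferInstance

instance tensorLeft_preservesFiniteColimits (Z : C) : PreservesFiniteColimits (tensorLeft Z) :=
  have := (Adjunction.ofIsLeftAdjoint (tensorLeft Z)).leftAdjoint_preservesColimits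
  inferInstance

instance tensorRight_preservesFiniteLimits (Z : C) : PreservesFiniteLimits (tensorRight Z) :=
  have := (Adjunction.ofIsRightAdjoint (tensorRight Z)).rightAdjoint_preservesLimits
  inferInstance

instance tensorRight_preservesFiniteColimits (Z : C) : PreservesFiniteColimits (tensorRight Z) :=
  have := (Adjunction.ofIsLeftAdjoint (tensorRight Z)).leftAdjoint_preservesColimits
  inferInstance

/-- The reassociation `V* ⊗ (V ⊗ (X ⊗ Y)) ≅ (V* ⊗ (V ⊗ X)) ⊗ Y`. -/
def reassoc (V X Y : C) : Vᘁ ⊗ (V ⊗ (X ⊗ Y)) ≅ (Vᘁ ⊗ (V ⊗ X)) ⊗ Y :=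
  whiskerLeftIso Vᘁ (α_ V X Y).symm ≪≫ (α_ Vᘁ (V ⊗ X) Y).symm

lemma reassoc_counit (V X Y : C) :
    (reassoc V X Y).hom ≫ (counit V X ▷ Y) = counit V (X ⊗ Y) := by
  simp only [reassoc, counit]
  simp

lemma unit_reassoc (V X Y : C) :
    unit V (X ⊗ Y) ≫ (reassoc V X Y).hom = unit V X ▷ Y := by
  simp only [reassoc, unit]
  simp

/-- `Ω_V (X ⊗ Y) ≅ Ω_V X ⊗ Y`. -/
def omegaTensorIso (V X Y : C) : (omega V).obj (X ⊗ Y) ≅ (omega V).obj X ⊗ Y :=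
  kernel.mapIso (counit V (X ⊗ Y)) ((tensorRight Y).map (counit V X)) (reassoc V X Y)
      (Iso.refl _) (by simpa using (reassoc_counit V X Y).symm) ≪≫
    (PreservesKernel.iso (tensorRight Y) (counit V X)).symm

/-- `Ω_V⁻¹ (X ⊗ Y) ≅ Ω_V⁻¹ X ⊗ Y`. -/
def omegaInvTensorIso (V X Y : C) : (omegaInv V).obj (X ⊗ Y) ≅ (omegaInv V).obj X ⊗ Y :=
  cokernel.mapIso (unit V (X ⊗ Y)) ((tensorRight Y).map (unit V X)) (Iso.refl _)
      (reassoc V X Y) (by simpa using unit_reassoc V X Y) ≪≫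
    (PreservesCokernel.iso (tensorRight Y) (unit V X)).symm

instance (V : C) : (omega V).Additive where
  map_add {X Y f g} := by
    apply (cancel_mono (kernel.ι (counit V Y))).1
    refine Eq.trans ?_ (Preadditive.add_comp _ _ _ _ _ _).symm
    simp [omega]
    rfl

instance (V : C) : (omegaInv V).Additive where
  map_add {X Y f g} := by
    apply (cancel_epi (cokernel.π (unit V X))).1
    refine Eq.trans ?_ (Preadditive.comp_add _ _ _ _ _ _).symm
    simp [omegaInv]
    rfl

/-- An additive endofunctor `H` with `H (X ⊗ Y) ≅ H X ⊗ Y` preserves the morphisms that factor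
through a `W`-projective object. -/
lemma FactorsThroughProjective.map {W : C} (H : C ⥤ C)
    (e : ∀ X Y : C, H.obj (X ⊗ Y) ≅ H.obj X ⊗ Y) {X Y : C} {f : X ⟶ Y}
    (hf : FactorsThroughProjective W f) : FactorsThroughProjective W (H.map f) := by
  obtain ⟨Q, a, b, rfl⟩ := hf.exists_tensor
  exact ⟨H.obj (Wᘁ ⊗ Q), H.map a, H.map b,
    ⟨H.obj Q, ⟨Retract.ofIso (H.mapIso (β_ Wᘁ Q) ≪≫ e Q Wᘁ ≪≫ β_ (H.obj Q) Wᘁ)⟩⟩, by simp⟩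

/-- The endofunctor of the `W`-stable category induced by `Ω_V`. -/
def stableOmega (W V : C) : StableCat W ⥤ StableCat W :=
  CategoryTheory.Quotient.lift (stableRel W) (omega V ⋙ toStable W) fun X Y f g h => by
    refine CategoryTheory.Quotient.sound _ ?_
    have := FactorsThroughProjective.map (omega V) (omegaTensorIso V) h
    rwa [Functor.map_sub] at this

/-- The shift functor of the `W`-stable category, induced by `Ω_W⁻¹`. -/
def stableShift (W : C) : StableCat W ⥤ StableCat W :=
  CategoryTheory.Quotient.lift (stableRel W) (omegaInv W ⋙ toStable W) fun X Y f g h => by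
    refine CategoryTheory.Quotient.sound _ ?_
    have := FactorsThroughProjective.map (omegaInv W) (omegaInvTensorIso W) h
    rwa [Functor.map_sub] at this

/-! ### Triangles and thick subcategories of the `W`-stable category -/

/-- A triangle `X₁ ⟶ X₂ ⟶ X₃ ⟶ X₁[1]` in the `W`-stable category. -/
structure StableTriangle (W : C) where
  /-- the first object -/
  X₁ : StableCat W
  /-- the second object -/
  X₂ : StableCat W
  /-- the third object -/
  X₃ : StableCat W
  /-- the first morphism -/
  f : X₁ ⟶ X₂
  /-- the second morphism -/
  g : X₂ ⟶ X₃
  /-- the third morphism -/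
  h : X₃ ⟶ (stableShift W).obj X₁

/-- An isomorphism of triangles. -/
structure StableTriangle.Iso {W : C} (S T : StableTriangle W) where
  /-- the isomorphism of the first objects -/
  e₁ : S.X₁ ≅ T.X₁
  /-- the isomorphism of the second objects -/
  e₂ : S.X₂ ≅ T.X₂
  /-- the isomorphism of the third objects -/
  e₃ : S.X₃ ≅ T.X₃
  comm_f : S.f ≫ e₂.hom = e₁.hom ≫ T.f
  comm_g : S.g ≫ e₃.hom = e₂.hom ≫ T.g
  comm_h : S.h ≫ (stableShift W).map e₁.hom = e₃.hom ≫ T.h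

/-- The triangle given by a short complex `S` of `C` and a morphism `S.X₃ ⟶ Ω_W⁻¹ S.X₁`. -/
def StableTriangle.mk' (W : C) (S : ShortComplex C) (h : S.X₃ ⟶ (omegaInv W).obj S.X₁) :
    StableTriangle W where
  X₁ := (toStable W).obj S.X₁
  X₂ := (toStable W).obj S.X₂
  X₃ := (toStable W).obj S.X₃
  f := (toStable W).map S.f
  g := (toStable W).map S.g
  h := (toStable W).map h

/-- The distinguished triangles: those isomorphic to a triangle coming from a `W`-split short exact
sequence `0 ⟶ X₁ ⟶ X₂ ⟶ X₃ ⟶ 0`, i.e. one that splits after applying `W ⊗ -`. The connecting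
morphism is obtained by extending the unit `X₁ ⟶ W* ⊗ W ⊗ X₁` to a morphism
`φ : X₂ ⟶ W* ⊗ W ⊗ X₁` and passing to cokernels. -/
def IsDistinguished {W : C} (T : StableTriangle W) : Prop :=
  ∃ (S : ShortComplex C) (φ : S.X₂ ⟶ Wᘁ ⊗ (W ⊗ S.X₁)) (h : S.X₃ ⟶ (omegaInv W).obj S.X₁),
    S.ShortExact ∧ Nonempty (S.map (tensorLeft W)).Splitting ∧
    S.f ≫ φ = unit W S.X₁ ∧ φ ≫ cokernel.π (unit W S.X₁) = S.g ≫ h ∧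
    Nonempty (T.Iso (StableTriangle.mk' W S h))

/-- A thick subcategory of the `W`-stable category, given by its class of objects: a (strictly
full) triangulated subcategory closed under direct summands. Note that `Ω_W` is the inverse of the
shift functor. -/
structure IsThick {W : C} (P : ObjectProperty (StableCat W)) : Prop where
  zero_mem : ∃ Z : StableCat W, IsZero Z ∧ P Z
  shift_mem : ∀ X, P X → P ((stableShift W).obj X)
  unshift_mem : ∀ X, P X → P ((stableOmega W W).obj X)
  mem₁ : ∀ T : StableTriangle W, IsDistinguished T → P T.X₂ → P T.X₃ → P T.X₁
  mem₂ : ∀ T : StableTriangle W, IsDistinguished T → P T.X₁ → P T.X₃ → P T.X₂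
  mem₃ : ∀ T : StableTriangle W, IsDistinguished T → P T.X₁ → P T.X₂ → P T.X₃
  iso_mem : ∀ X Y : StableCat W, (X ≅ Y) → P X → P Y
  retract_mem : ∀ X Y : StableCat W, Retract X Y → P Y → P X

/-- For an endofunctor `F`, the class of objects `X` such that for every `Y` every morphism
`Fⁿ X ⟶ Y` is zero for all sufficiently large `n`. -/
def eventuallyZero {T : Type*} [Category T] [Preadditive T] (F : T ⥤ T) :
    ObjectProperty T :=
  fun X => ∀ Y : T, ∃ N : ℕ, ∀ n : ℕ, N ≤ n → ∀ f : F.obj^[n] X ⟶ Y, f = 0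

/-! ### Transfer and virtual projectivity -/

/-- The transfer map `Extⁿ(W ⊗ X, W ⊗ Y) → Extⁿ(X, Y)`: the composite of the adjunction map
`Extⁿ(W ⊗ X, W ⊗ Y) → Extⁿ(X, W* ⊗ W ⊗ Y)` and the map induced by the counit
`W* ⊗ W ⊗ Y ⟶ Y`. -/
def transfer [HasExt.{w} C] (W X Y : C) (n : ℕ) (a : Abelian.Ext.{w} (W ⊗ X) (W ⊗ Y) n) :
    Abelian.Ext.{w} X Y n :=
  let b : Abelian.Ext.{w} (Wᘁ ⊗ (W ⊗ X)) (Wᘁ ⊗ (W ⊗ Y)) n := a.mapExactFunctor (tensorLeft Wᘁ)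
  let c : Abelian.Ext.{w} X (Wᘁ ⊗ (W ⊗ Y)) n :=
    (Abelian.Ext.mk₀ (unit W X)).comp b (zero_add n)
  c.comp (Abelian.Ext.mk₀ (counit W Y)) (add_zero n)

/-- `X` is virtually `W`-projective: for every `Y`, the transfer map
`Extⁿ(W ⊗ X, W ⊗ Y) → Extⁿ(X, Y)` is surjective for all sufficiently large `n`. -/
def IsVirtuallyProjective [HasExt.{w} C] (W X : C) : Prop :=
  ∀ Y : C, ∃ N : ℕ, ∀ n : ℕ, N ≤ n → Function.Surjective (transfer.{w} W X Y n)

end General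

/-! ### Finite groups -/

variable (k G : Type u) [Field k] [Group G] [Finite G]

/-- Ext-groups are always available in a sufficiently large universe. -/
instance : HasExt.{u + 1} (FDRep k G) := HasExt.standard _

/-- The regular module `kG`. -/
def regular : FDRep k G := FDRep.of (Representation.leftRegular k G)

end RelStable

end

/-!
The whole theorem reduces to two facts about an abelian symmetric rigid category `C` and an object
`W` of it.

*Thickness.* Since `Ω_V (X ⊗ Y) ≅ Ω_V X ⊗ Y`, the iterate `Ω_Vⁿ X` is `Ω_Vⁿ 𝟙 ⊗ X`, and the
adjunction between `A ⊗ -` and `A* ⊗ -` descends to the stable category. So `(Ω_Vⁿ X, Y)_W = 0` is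
equivalent to `(X, Aₙ ⊗ Y)_W = 0`, where `Aₙ` is the dual of `Ω_Vⁿ 𝟙`
(`eventuallyZero_stableOmega_iff_dualOmega`). This description makes the class of `Ω_V` visibly a
tensor ideal, hence closed under `Ω_W^{±1} = Ω_W^{±1} 𝟙 ⊗ -`. For triangles it remains to know that
a `W`-split short exact sequence `0 ⟶ X₁ ⟶ X₂ ⟶ X₃ ⟶ 0` gives exact sequences of stable Hom-groups
into a fixed object `Z` (`StableHomZero.middle`, `StableHomZero.right`, `StableHomZero.left`). These
are short diagram chases: `W`-projective objects are both injective and projective relative to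
`W`-split sequences. Rotating a triangle replaces `Z` by `Ω_W^{±1} Z`, and
`Ω_W^{±1} (Aₙ ⊗ Y) ≅ Aₙ ⊗ Ω_W^{±1} Y`, so only the quantified object `Y` changes.

*Virtual projectivity.* The image of the transfer map is the image of
`Extⁿ(X, W* ⊗ W ⊗ Y) ⟶ Extⁿ(X, Y)` (`surjective_transfer_iff`). Whether this map is surjective is
unchanged by dimension shifting from `(X, n + 1)` to `(Ω X, n)`, because projective objects are
`W`-projective (`ext_comp_counit_surjective_succ_iff`). Shifting down to degree zero, surjectivity in
degree `n` says that every morphism `Ωⁿ X ⟶ Y` factors through the counit `W* ⊗ W ⊗ Y ⟶ Y`, that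
is, `(Ωⁿ X, Y)_W = 0`.

For representations of a finite group the tensor unit is simple, so evaluation at a nonzero `W` is an
epimorphism and coevaluation a monomorphism, and `kG* ⊗ kG ⊗ X` is projective, so `Ω_{kG}` computes
syzygies.
-/

noncomputable section

namespace RelStable

section General

variable {C : Type u} [Category.{v} C] [Abelian C] [MonoidalCategory C] [MonoidalPreadditive C]
  [SymmetricCategory C] [RightRigidCategory C]

/-! ### The adjunctions between `W ⊗ -` and `W* ⊗ -` -/

/-- The adjunction `W* ⊗ - ⊣ W ⊗ -`, whose counit is `counit`. -/
def dualTensorAdj (W : C) : tensorLeft Wᘁ ⊣ tensorLeft W := tensorLeftAdjunction W Wᘁ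

/-- The adjunction `W ⊗ - ⊣ W* ⊗ -` given by the braided exact pairing, whose unit is `unit`. -/
def tensorDualAdj (W : C) : tensorLeft W ⊣ tensorLeft Wᘁ :=
  letI := BraidedCategory.exactPairing_swap W Wᘁ
  tensorLeftAdjunction Wᘁ W

lemma dualTensorAdj_counit_app (W X : C) : (dualTensorAdj W).counit.app X = counit W X := by
  simp [dualTensorAdj, tensorLeftAdjunction, counit, tensorLeftHomEquiv]

lemma tensorDualAdj_unit_app (W X : C) : (tensorDualAdj W).unit.app X = unit W X := by
  have h : (β_ Wᘁ W).inv = (β_ W Wᘁ).hom :=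
    (SymmetricCategory.braiding_swap_eq_inv_braiding Wᘁ W).symm
  rw [unit, ← h]
  let := BraidedCategory.exactPairing_swap W Wᘁ
  change (λ_ X).inv ≫ (η_ W Wᘁ ≫ (β_ Wᘁ W).inv) ▷ X ≫ (α_ Wᘁ W X).hom ≫ Wᘁ ◁ 𝟙 (W ⊗ X) = _
  simp

/-- A morphism from a `W`-projective object lifts through the counit. -/
lemma IsRelProjective.exists_lift_counit {W P Z : C} (hP : IsRelProjective W P) (f : P ⟶ Z) :
    ∃ g : P ⟶ Wᘁ ⊗ (W ⊗ Z), g ≫ counit W Z = f := by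
  obtain ⟨Q, ⟨r⟩⟩ := hP
  let u : Q ⟶ W ⊗ (Wᘁ ⊗ Q) := (dualTensorAdj W).unit.app Q
  refine ⟨r.i ≫ (Wᘁ ◁ u) ≫ (Wᘁ ◁ (W ◁ (r.r ≫ f))), ?_⟩
  have h := (dualTensorAdj W).left_triangle_components Q
  rw [dualTensorAdj_counit_app] at h
  replace h : Wᘁ ◁ u ≫ counit W (Wᘁ ⊗ Q) = 𝟙 (Wᘁ ⊗ Q) := h
  simp only [Category.assoc, counit_naturality]
  rw [reassoc_of% h]
  simp

/-- A morphism to a `W`-projective object extends along the unit. -/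
lemma IsRelProjective.exists_extend_unit {W X P : C} (hP : IsRelProjective W P) (f : X ⟶ P) :
    ∃ g : Wᘁ ⊗ (W ⊗ X) ⟶ P, unit W X ≫ g = f := by
  obtain ⟨Q, ⟨r⟩⟩ := hP
  refine ⟨(Wᘁ ◁ (W ◁ (f ≫ r.i))) ≫ (Wᘁ ◁ (tensorDualAdj W).counit.app Q) ≫ r.r, ?_⟩
  have h := (tensorDualAdj W).right_triangle_components Q
  rw [tensorDualAdj_unit_app] at h
  replace h : unit W (Wᘁ ⊗ Q) ≫ Wᘁ ◁ (tensorDualAdj W).counit.app Q = 𝟙 (Wᘁ ⊗ Q) := h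
  rw [← reassoc_of% unit_naturality, reassoc_of% h]
  simp

/-- `W`-projective objects are injective relative to morphisms that become split monomorphisms
after applying `W ⊗ -`. -/
lemma IsRelProjective.exists_extend {W X Y P : C} (hP : IsRelProjective W P) (i : X ⟶ Y)
    (hi : IsSplitMono (W ◁ i)) (f : X ⟶ P) : ∃ g : Y ⟶ P, i ≫ g = f := by
  obtain ⟨f', rfl⟩ := hP.exists_extend_unit f
  refine ⟨unit W Y ≫ (Wᘁ ◁ retraction (W ◁ i)) ≫ f', ?_⟩
  rw [reassoc_of% unit_naturality, ← MonoidalCategory.whiskerLeft_comp_assoc]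
  simp

/-- `W`-projective objects are projective relative to morphisms that become split epimorphisms
after applying `W ⊗ -`. -/
lemma IsRelProjective.exists_lift {W X Y P : C} (hP : IsRelProjective W P) (p : X ⟶ Y)
    (hp : IsSplitEpi (W ◁ p)) (f : P ⟶ Y) : ∃ g : P ⟶ X, g ≫ p = f := by
  obtain ⟨f', rfl⟩ := hP.exists_lift_counit f
  refine ⟨f' ≫ (Wᘁ ◁ section_ (W ◁ p)) ≫ counit W X, ?_⟩
  simp only [Category.assoc, ← counit_naturality]
  rw [← MonoidalCategory.whiskerLeft_comp_assoc]
  simp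

lemma FactorsThroughProjective.exists_lift {W X Y Z : C} {f : X ⟶ Y}
    (hf : FactorsThroughProjective W f) (p : Z ⟶ Y) (hp : IsSplitEpi (W ◁ p)) :
    ∃ g : X ⟶ Z, g ≫ p = f := by
  obtain ⟨P, a, b, hP, rfl⟩ := hf
  obtain ⟨g, rfl⟩ := hP.exists_lift p hp b
  exact ⟨a ≫ g, by simp⟩

lemma FactorsThroughProjective.exists_extend {W X Y Z : C} {f : X ⟶ Y}
    (hf : FactorsThroughProjective W f) (i : X ⟶ Z) (hi : IsSplitMono (W ◁ i)) :
    ∃ g : Z ⟶ Y, i ≫ g = f := by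
  obtain ⟨P, a, b, hP, rfl⟩ := hf
  obtain ⟨g, rfl⟩ := hP.exists_extend i hi a
  exact ⟨g ≫ b, by simp⟩

lemma FactorsThroughProjective.exists_comp_counit {W X Y : C} {f : X ⟶ Y}
    (hf : FactorsThroughProjective W f) :
    ∃ a : X ⟶ Wᘁ ⊗ (W ⊗ Y), a ≫ counit W Y = f := by
  obtain ⟨P, a, b, hP, rfl⟩ := hf
  obtain ⟨g, rfl⟩ := hP.exists_lift_counit b
  exact ⟨a ≫ g, by simp⟩

lemma factorsThroughProjective_comp_counit {W X Y : C} (a : X ⟶ Wᘁ ⊗ (W ⊗ Y)) :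
    FactorsThroughProjective W (a ≫ counit W Y) :=
  ⟨_, a, _, isRelProjective_tensor _ _, rfl⟩

/-- The sequence `X ⟶ W* ⊗ W ⊗ X ⟶ Ω_W⁻¹ X` splits after applying `W ⊗ -`: by a triangle identity
`W ⊗ X ⟶ W ⊗ W* ⊗ W ⊗ X` has a retraction `r`, and `𝟙 - r ≫ (W ◁ unit)` factors through the cokernel
`W ⊗ Ω_W⁻¹ X`. -/
lemma isSplitEpi_whiskerLeft_cokernel_unit (W X : C) :
    IsSplitEpi (W ◁ cokernel.π (unit W X)) := by
  have h := (tensorDualAdj W).left_triangle_components X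
  rw [tensorDualAdj_unit_app] at h
  replace h : W ◁ unit W X ≫ (tensorDualAdj W).counit.app (W ⊗ X) = 𝟙 (W ⊗ X) := h
  have hc := isColimitOfHasCokernelOfPreservesColimit (tensorLeft W) (unit W X)
  have : Epi (W ◁ cokernel.π (unit W X)) :=
    inferInstanceAs (Epi ((tensorLeft W).map (cokernel.π (unit W X))))
  let d : W ⊗ (Wᘁ ⊗ (W ⊗ X)) ⟶ W ⊗ (Wᘁ ⊗ (W ⊗ X)) :=
    𝟙 _ - (tensorDualAdj W).counit.app (W ⊗ X) ≫ W ◁ unit W X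
  have hd : W ◁ unit W X ≫ d = 0 := by
    simp only [d, Preadditive.comp_sub, reassoc_of% h]
    simp
  obtain ⟨s, hs⟩ := CokernelCofork.IsColimit.desc' hc d hd
  replace hs : W ◁ cokernel.π (unit W X) ≫ s = d := hs
  refine ⟨⟨s, ?_⟩⟩
  rw [← cancel_epi (W ◁ cokernel.π (unit W X)), reassoc_of% hs]
  simp only [d, Preadditive.sub_comp, Category.assoc]
  rw [← MonoidalCategory.whiskerLeft_comp]
  simp

/-! ### Vanishing of stable Hom-groups -/

/-- The group `(X, Z)_W` of morphisms in the `W`-stable category vanishes: every morphism `X ⟶ Z`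
factors through a `W`-projective object. -/
def StableHomZero (W X Z : C) : Prop := ∀ f : X ⟶ Z, FactorsThroughProjective W f

lemma toStable_map_eq_zero_iff {W X Z : C} (f : X ⟶ Z) :
    (toStable W).map f = 0 ↔ FactorsThroughProjective W f := by
  have h : (0 : (toStable W).obj X ⟶ (toStable W).obj Z) = (toStable W).map 0 := rfl
  rw [h, Quotient.functor_map_eq_iff, stableRel, sub_zero]

lemma stableHomZero_iff {W X Z : C} :
    StableHomZero W X Z ↔ ∀ f : (toStable W).obj X ⟶ (toStable W).obj Z, f = 0 := by
  refine ⟨fun h f => ?_, fun h f => (toStable_map_eq_zero_iff f).1 (h _)⟩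
  obtain ⟨f, rfl⟩ := (toStable W).map_surjective f
  exact (toStable_map_eq_zero_iff f).2 (h f)

lemma StableHomZero.of_iso {W X X' Z Z' : C} (h : StableHomZero W X Z) (e : X ≅ X') (e' : Z ≅ Z') :
    StableHomZero W X' Z' := fun f => by
  simpa using ((h (e.hom ≫ f ≫ e'.inv)).comp_left e.inv).comp_right e'.hom

lemma FactorsThroughProjective.whiskerLeft {W X Y : C} {f : X ⟶ Y}
    (hf : FactorsThroughProjective W f) (A : C) : FactorsThroughProjective W (A ◁ f) :=
  FactorsThroughProjective.map (tensorLeft A) (fun X Y => (α_ A X Y).symm) hf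

/-- The adjunction between `A ⊗ -` and `A* ⊗ -` descends to the `W`-stable category. -/
lemma stableHomZero_tensor_left_iff {W A X Z : C} :
    StableHomZero W (A ⊗ X) Z ↔ StableHomZero W X (Aᘁ ⊗ Z) := by
  refine ⟨fun h f => ?_, fun h f => ?_⟩
  · rw [← ((tensorDualAdj A).homEquiv X Z).apply_symm_apply f, Adjunction.homEquiv_unit]
    exact ((h _).whiskerLeft _).comp_left _
  · rw [← ((tensorDualAdj A).homEquiv X Z).symm_apply_apply f, Adjunction.homEquiv_counit]
    exact ((h _).whiskerLeft _).comp_right _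

section ShortExact

variable {W : C} {S : ShortComplex C} (hS : S.ShortExact)
  (σ : (S.map (tensorLeft W)).Splitting)

include σ

lemma isSplitMono_of_splitting : IsSplitMono (W ◁ S.f) := ⟨⟨σ.r, σ.f_r⟩⟩

lemma isSplitEpi_of_splitting : IsSplitEpi (W ◁ S.g) := ⟨⟨σ.s, σ.s_g⟩⟩

include hS

/-- Vanishing in the middle, from the exactness of `(X₃, Z)_W ⟶ (X₂, Z)_W ⟶ (X₁, Z)_W` for a
`W`-split short exact sequence. -/
lemma StableHomZero.middle {Z : C} (h₁ : StableHomZero W S.X₁ Z) (h₃ : StableHomZero W S.X₃ Z) :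
    StableHomZero W S.X₂ Z := fun f => by
  have := hS.epi_g
  obtain ⟨a, ha⟩ := (h₁ (S.f ≫ f)).exists_comp_counit
  obtain ⟨a', rfl⟩ :=
    (isRelProjective_tensor W _).exists_extend S.f (isSplitMono_of_splitting σ) a
  have hk : S.f ≫ (f - a' ≫ counit W Z) = 0 := by
    rw [Preadditive.comp_sub, ← ha]; simp
  have hc := hS.exact.g_desc _ hk
  rw [← sub_add_cancel f (a' ≫ counit W Z), ← hc]
  exact ((h₃ _).comp_left _).add (factorsThroughProjective_comp_counit _)

/-- Vanishing in the middle, from the exactness of `(X₁, Ω_W Z)_W ⟶ (X₃, Z)_W ⟶ (X₂, Z)_W` for a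
`W`-split short exact sequence. -/
lemma StableHomZero.right {Z : C} (h₁ : StableHomZero W S.X₁ ((omega W).obj Z))
    (h₂ : StableHomZero W S.X₂ Z) : StableHomZero W S.X₃ Z := fun f => by
  have := hS.epi_g
  obtain ⟨a, ha⟩ := (h₂ (S.g ≫ f)).exists_comp_counit
  -- `S.f ≫ a` takes values in the kernel `Ω_W Z` of the counit
  let j : (omega W).obj Z ⟶ Wᘁ ⊗ (W ⊗ Z) := kernel.ι (counit W Z)
  have hj : j ≫ counit W Z = 0 := kernel.condition _
  let b : S.X₁ ⟶ (omega W).obj Z := kernel.lift (counit W Z) (S.f ≫ a) (by simp [ha])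
  have hb : b ≫ j = S.f ≫ a := kernel.lift_ι _ _ _
  obtain ⟨b', hb'⟩ := (h₁ b).exists_extend S.f (isSplitMono_of_splitting σ)
  have hk : S.f ≫ (a - b' ≫ j) = 0 := by
    rw [Preadditive.comp_sub, reassoc_of% hb', hb, sub_self]
  have hc := hS.exact.g_desc _ hk
  have hf : f = hS.exact.desc _ hk ≫ counit W Z := by
    rw [← cancel_epi S.g, reassoc_of% hc, Preadditive.sub_comp, ha, Category.assoc, hj]
    simp
  rw [hf]
  exact factorsThroughProjective_comp_counit _

/-- Vanishing in the middle, from the exactness of `(X₂, Z)_W ⟶ (X₁, Z)_W ⟶ (X₃, Ω_W⁻¹ Z)_W` for a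
`W`-split short exact sequence. -/
lemma StableHomZero.left {Z : C} [Mono (unit W Z)]
    (h₂ : StableHomZero W S.X₂ Z) (h₃ : StableHomZero W S.X₃ ((omegaInv W).obj Z)) :
    StableHomZero W S.X₁ Z := fun f => by
  have := hS.epi_g
  let q : Wᘁ ⊗ (W ⊗ Z) ⟶ (omegaInv W).obj Z := cokernel.π (unit W Z)
  obtain ⟨c, hc⟩ := (isRelProjective_tensor W _).exists_extend S.f
    (isSplitMono_of_splitting σ) (f ≫ unit W Z)
  have hq : unit W Z ≫ q = 0 := cokernel.condition _
  have hk : S.f ≫ c ≫ q = 0 := by rw [reassoc_of% hc, hq, comp_zero]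
  obtain ⟨d, hd⟩ := (h₃ (hS.exact.desc _ hk)).exists_lift q
    (isSplitEpi_whiskerLeft_cokernel_unit W Z)
  have hz : (c - S.g ≫ d) ≫ cokernel.π (unit W Z) = 0 := by
    change (c - S.g ≫ d) ≫ q = 0
    rw [Preadditive.sub_comp, Category.assoc, hd, hS.exact.g_desc, sub_self]
  -- so `c - S.g ≫ d` takes values in `Z`, and it still restricts to `f ≫ unit W Z`
  let t : S.X₂ ⟶ Z := Abelian.monoLift (unit W Z) _ hz
  have ht : t ≫ unit W Z = c - S.g ≫ d := Abelian.monoLift_comp _ _ _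
  have hf : f = S.f ≫ t := by
    rw [← cancel_mono (unit W Z), Category.assoc, ht, Preadditive.comp_sub, hc]
    simp
  rw [hf]
  exact (h₂ t).comp_left _

end ShortExact

end General

/-! ### Iterated translates and thickness -/

section Retract

variable {T : Type*} [Category T] [Preadditive T] (F : T ⥤ T)

lemma nonempty_retract_iterate {X Y : T} (r : Retract X Y) (n : ℕ) :
    Nonempty (Retract (F.obj^[n] X) (F.obj^[n] Y)) := by
  induction n generalizing X Y with
  | zero => exact ⟨r⟩
  | succ n ih => exact ih (r.map F)

lemma nonempty_iso_iterate {X Y : T} (e : X ≅ Y) (n : ℕ) :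
    Nonempty (F.obj^[n] X ≅ F.obj^[n] Y) := by
  induction n generalizing X Y with
  | zero => exact ⟨e⟩
  | succ n ih => exact ih (F.mapIso e)

variable {F}

lemma eventuallyZero.of_retract {X Y : T} (hY : eventuallyZero F Y) (r : Retract X Y) :
    eventuallyZero F X := fun Z => by
  obtain ⟨N, hN⟩ := hY Z
  refine ⟨N, fun n hn f => ?_⟩
  obtain ⟨s⟩ := nonempty_retract_iterate F r n
  have h := hN n hn (s.r ≫ f)
  rw [← Category.id_comp f, ← s.retract, Category.assoc, h, comp_zero]

lemma eventuallyZero.of_iso {X Y : T} (hX : eventuallyZero F X) (e : X ≅ Y) :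
    eventuallyZero F Y :=
  hX.of_retract (Retract.ofIso e.symm)

end Retract

section Thick

variable {C : Type u} [Category.{v} C] [Abelian C] [MonoidalCategory C] [MonoidalPreadditive C]
  [SymmetricCategory C] [RightRigidCategory C]

lemma stableOmega_iterate (W V X : C) (n : ℕ) :
    (stableOmega W V).obj^[n] ((toStable W).obj X) =
      (toStable W).obj ((omega V).obj^[n] X) := by
  induction n generalizing X with
  | zero => rfl
  | succ n ih => exact ih _

lemma nonempty_omega_iterate_tensorIso (V X Y : C) (n : ℕ) :
    Nonempty ((omega V).obj^[n] (X ⊗ Y) ≅ (omega V).obj^[n] X ⊗ Y) := by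
  induction n generalizing X with
  | zero => exact ⟨Iso.refl _⟩
  | succ n ih =>
    obtain ⟨e⟩ := nonempty_iso_iterate (omega V) (omegaTensorIso V X Y) n
    obtain ⟨e'⟩ := ih ((omega V).obj X)
    exact ⟨e ≪≫ e'⟩

lemma eventuallyZero_stableOmega_iff {W V X : C} :
    eventuallyZero (stableOmega W V) ((toStable W).obj X) ↔
      ∀ Y : C, ∃ N : ℕ, ∀ n : ℕ, N ≤ n → StableHomZero W ((omega V).obj^[n] X) Y := by
  refine ⟨fun h Y => ?_, fun h Y => ?_⟩
  · obtain ⟨N, hN⟩ := h ((toStable W).obj Y)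
    refine ⟨N, fun n hn => stableHomZero_iff.2 fun f => ?_⟩
    have h := hN n hn
    rw [stableOmega_iterate] at h
    exact h f
  · obtain ⟨N, hN⟩ := h Y.as
    refine ⟨N, fun n hn => ?_⟩
    rw [stableOmega_iterate]
    exact stableHomZero_iff.1 (hN n hn)

/-- The dual of the iterated translate of the tensor unit. Since `Ω_Vⁿ X ≅ Ω_Vⁿ 𝟙 ⊗ X`, tensoring
with it is right adjoint to `Ω_Vⁿ` on the stable category. -/
def dualOmega (V : C) (n : ℕ) : C := ((omega V).obj^[n] (𝟙_ C))ᘁ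

lemma stableHomZero_omega_iterate_iff {W V X Y : C} {n : ℕ} :
    StableHomZero W ((omega V).obj^[n] X) Y ↔ StableHomZero W X (dualOmega V n ⊗ Y) := by
  obtain ⟨e⟩ := nonempty_omega_iterate_tensorIso V (𝟙_ C) X n
  obtain ⟨e'⟩ := nonempty_iso_iterate (omega V) (λ_ X) n
  rw [dualOmega, ← stableHomZero_tensor_left_iff]
  exact ⟨fun h => h.of_iso (e'.symm ≪≫ e) (Iso.refl _),
    fun h => h.of_iso (e'.symm ≪≫ e).symm (Iso.refl _)⟩

/-- Membership in the class of `Ω_V`, with `Ω_Vⁿ` moved to the second variable by adjunction. The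
first variable is then free to run through a short exact sequence. -/
lemma eventuallyZero_stableOmega_iff_dualOmega {W V X : C} :
    eventuallyZero (stableOmega W V) ((toStable W).obj X) ↔
      ∀ Y : C, ∃ N : ℕ, ∀ n : ℕ, N ≤ n → StableHomZero W X (dualOmega V n ⊗ Y) := by
  simp only [eventuallyZero_stableOmega_iff, stableHomZero_omega_iterate_iff]

/-- The class of `Ω_V` is a tensor ideal. -/
lemma eventuallyZero_tensor {W V X : C} (A : C)
    (h : eventuallyZero (stableOmega W V) ((toStable W).obj X)) :
    eventuallyZero (stableOmega W V) ((toStable W).obj (A ⊗ X)) := by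
  rw [eventuallyZero_stableOmega_iff_dualOmega] at h ⊢
  intro Y
  obtain ⟨N, hN⟩ := h (Aᘁ ⊗ Y)
  refine ⟨N, fun n hn => stableHomZero_tensor_left_iff.2 ((hN n hn).of_iso (Iso.refl _) ?_)⟩
  exact (α_ _ _ _).symm ≪≫ whiskerRightIso (β_ _ _) Y ≪≫ α_ _ _ _

/-- `Ω_V (A ⊗ Y) ≅ A ⊗ Ω_V Y`. -/
def tensorOmegaIso (V A Y : C) : (omega V).obj (A ⊗ Y) ≅ A ⊗ (omega V).obj Y :=
  (omega V).mapIso (β_ A Y) ≪≫ omegaTensorIso V Y A ≪≫ β_ _ _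

/-- `Ω_V⁻¹ (A ⊗ Y) ≅ A ⊗ Ω_V⁻¹ Y`. -/
def tensorOmegaInvIso (V A Y : C) : (omegaInv V).obj (A ⊗ Y) ≅ A ⊗ (omegaInv V).obj Y :=
  (omegaInv V).mapIso (β_ A Y) ≪≫ omegaInvTensorIso V Y A ≪≫ β_ _ _

section

variable {W V : C} {S : ShortComplex C} (hS : S.ShortExact)
  (σ : (S.map (tensorLeft W)).Splitting)

include hS σ

lemma eventuallyZero_middle
    (h₁ : eventuallyZero (stableOmega W V) ((toStable W).obj S.X₁))
    (h₃ : eventuallyZero (stableOmega W V) ((toStable W).obj S.X₃)) :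
    eventuallyZero (stableOmega W V) ((toStable W).obj S.X₂) := by
  rw [eventuallyZero_stableOmega_iff_dualOmega] at h₁ h₃ ⊢
  intro Y
  obtain ⟨N₁, hN₁⟩ := h₁ Y
  obtain ⟨N₃, hN₃⟩ := h₃ Y
  exact ⟨max N₁ N₃, fun n hn => StableHomZero.middle hS σ (hN₁ n (le_of_max_le_left hn))
    (hN₃ n (le_of_max_le_right hn))⟩

lemma eventuallyZero_right
    (h₁ : eventuallyZero (stableOmega W V) ((toStable W).obj S.X₁))
    (h₂ : eventuallyZero (stableOmega W V) ((toStable W).obj S.X₂)) :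
    eventuallyZero (stableOmega W V) ((toStable W).obj S.X₃) := by
  rw [eventuallyZero_stableOmega_iff_dualOmega] at h₁ h₂ ⊢
  intro Y
  obtain ⟨N₁, hN₁⟩ := h₁ ((omega W).obj Y)
  obtain ⟨N₂, hN₂⟩ := h₂ Y
  exact ⟨max N₁ N₂, fun n hn => StableHomZero.right hS σ
    ((hN₁ n (le_of_max_le_left hn)).of_iso (Iso.refl _) (tensorOmegaIso W _ Y).symm)
    (hN₂ n (le_of_max_le_right hn))⟩

lemma eventuallyZero_left [∀ Z : C, Mono (unit W Z)]
    (h₂ : eventuallyZero (stableOmega W V) ((toStable W).obj S.X₂))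
    (h₃ : eventuallyZero (stableOmega W V) ((toStable W).obj S.X₃)) :
    eventuallyZero (stableOmega W V) ((toStable W).obj S.X₁) := by
  rw [eventuallyZero_stableOmega_iff_dualOmega] at h₂ h₃ ⊢
  intro Y
  obtain ⟨N₂, hN₂⟩ := h₂ Y
  obtain ⟨N₃, hN₃⟩ := h₃ ((omegaInv W).obj Y)
  exact ⟨max N₂ N₃, fun n hn => StableHomZero.left hS σ (hN₂ n (le_of_max_le_left hn))
    ((hN₃ n (le_of_max_le_right hn)).of_iso (Iso.refl _) (tensorOmegaInvIso W _ Y).symm)⟩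

end

/-- The class of `Ω_V` is a thick subcategory of the `W`-stable category. The assumption on the unit
holds for every nonzero `W` when the tensor unit is simple. -/
theorem isThick_eventuallyZero (W V : C) [∀ Z : C, Mono (unit W Z)] :
    IsThick (eventuallyZero (stableOmega W V)) where
  zero_mem := by
    obtain ⟨Z, hZ⟩ := HasZeroObject.zero (C := C)
    refine ⟨(toStable W).obj Z, ?_, ?_⟩
    · rw [IsZero.iff_id_eq_zero]
      exact stableHomZero_iff.1 (fun f => by
        rw [hZ.eq_of_src f 0]
        exact FactorsThroughProjective.zero W _ _) _
    · rw [eventuallyZero_stableOmega_iff_dualOmega]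
      refine fun Y => ⟨0, fun n _ f => ?_⟩
      rw [hZ.eq_of_src f 0]
      exact FactorsThroughProjective.zero W _ _
  shift_mem X hX :=
    (eventuallyZero_tensor ((omegaInv W).obj (𝟙_ C)) hX).of_iso ((toStable W).mapIso
      ((omegaInvTensorIso W (𝟙_ C) X.as).symm ≪≫ (omegaInv W).mapIso (λ_ X.as)))
  unshift_mem X hX :=
    (eventuallyZero_tensor ((omega W).obj (𝟙_ C)) hX).of_iso ((toStable W).mapIso
      ((omegaTensorIso W (𝟙_ C) X.as).symm ≪≫ (omega W).mapIso (λ_ X.as)))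
  mem₁ := by
    rintro T ⟨S, φ, h, hS, ⟨σ⟩, -, -, ⟨e⟩⟩ h₂ h₃
    exact (eventuallyZero_left hS σ (h₂.of_iso e.e₂) (h₃.of_iso e.e₃)).of_iso e.e₁.symm
  mem₂ := by
    rintro T ⟨S, φ, h, hS, ⟨σ⟩, -, -, ⟨e⟩⟩ h₁ h₃
    exact (eventuallyZero_middle hS σ (h₁.of_iso e.e₁) (h₃.of_iso e.e₃)).of_iso e.e₂.symm
  mem₃ := by
    rintro T ⟨S, φ, h, hS, ⟨σ⟩, -, -, ⟨e⟩⟩ h₁ h₂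
    exact (eventuallyZero_right hS σ (h₁.of_iso e.e₁) (h₂.of_iso e.e₂)).of_iso e.e₃.symm
  iso_mem X Y e hX := hX.of_iso e
  retract_mem X Y r hY := hY.of_retract r

end Thick

/-! ### Transfer and dimension shifting -/

section Transfer

open Abelian

variable {C : Type u} [Category.{v} C] [Abelian C] [MonoidalCategory C] [MonoidalPreadditive C]
  [SymmetricCategory C] [RightRigidCategory C] [HasExt.{w} C]

/-- The morphism from a short complex `S` to `W* ⊗ W ⊗ S` given by the units. -/
def unitShortComplexHom (W : C) (S : ShortComplex C) :
    S ⟶ (S.map (tensorLeft W)).map (tensorLeft Wᘁ) where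
  τ₁ := unit W S.X₁
  τ₂ := unit W S.X₂
  τ₃ := unit W S.X₃
  comm₁₂ := (unit_naturality W S.f).symm
  comm₂₃ := (unit_naturality W S.g).symm

lemma extClass_unit_naturality (W : C) {S : ShortComplex C} (hS : S.ShortExact) :
    (Ext.mk₀ (unit W S.X₃)).comp
        ((hS.extClass.mapExactFunctor (tensorLeft W)).mapExactFunctor (tensorLeft Wᘁ))
        (zero_add 1) =
      hS.extClass.comp (Ext.mk₀ (unit W S.X₁)) (add_zero 1) := by
  have h₁ : (hS.extClass.mapExactFunctor (tensorLeft W)).mapExactFunctor (tensorLeft Wᘁ) =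
      ((hS.map_of_exact (tensorLeft W)).map_of_exact (tensorLeft Wᘁ)).extClass :=
    (congrArg (Ext.mapExactFunctor (tensorLeft Wᘁ))
      (Ext.mapExactFunctor_extClass (tensorLeft W) hS)).trans
      (Ext.mapExactFunctor_extClass (tensorLeft Wᘁ) (hS.map_of_exact (tensorLeft W)))
  exact (congrArg (fun e => (Ext.mk₀ (unit W S.X₃)).comp e (zero_add 1)) h₁).trans
    (hS.extClass_naturality _ (unitShortComplexHom W S)).symm

/-- Naturality of the unit with respect to Ext-classes. The case of degree one is the naturality of
the class of an extension; dimension shifting along projective resolutions reduces to it. -/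
lemma ext_unit_naturality [EnoughProjectives C] (W : C) {X Z : C} {n : ℕ} (c : Ext.{w} X Z n) :
    (Ext.mk₀ (unit W X)).comp
        ((c.mapExactFunctor (tensorLeft W)).mapExactFunctor (tensorLeft Wᘁ)) (zero_add n) =
      c.comp (Ext.mk₀ (unit W Z)) (add_zero n) := by
  induction n generalizing X with
  | zero =>
    obtain ⟨f, rfl⟩ := (Ext.mk₀_bijective X Z).2 c
    rw [Ext.mapExactFunctor_mk₀, Ext.mapExactFunctor_mk₀, Ext.mk₀_comp_mk₀, Ext.mk₀_comp_mk₀]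
    exact congrArg _ (unit_naturality W f).symm
  | succ n ih =>
    let S : ShortComplex C := ShortComplex.mk (kernel.ι (Projective.π X)) (Projective.π X) (by simp)
    have hS : S.ShortExact :=
      { exact := ShortComplex.exact_of_f_is_kernel _ (kernelIsKernel _) }
    obtain ⟨y, rfl⟩ : ∃ y, hS.extClass.comp y (add_comm 1 n) = c :=
      Ext.contravariant_sequence_exact₃ hS Z c (Ext.eq_zero_of_projective _) _
    rw [Ext.mapExactFunctor_comp, Ext.mapExactFunctor_comp,
      ← Ext.comp_assoc _ _ _ (zero_add 1) (add_comm 1 n) (by omega),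
      extClass_unit_naturality W hS, Ext.comp_assoc_of_second_deg_zero, ih y,
      Ext.comp_assoc_of_third_deg_zero]

/-- The transfer map has the same image as the map induced by the counit, because the adjunction map
`Extⁿ(W ⊗ X, W ⊗ Y) ⟶ Extⁿ(X, W* ⊗ W ⊗ Y)` is surjective. -/
lemma surjective_transfer_iff [EnoughProjectives C] {W X Y : C} {n : ℕ} :
    Function.Surjective (transfer.{w} W X Y n) ↔
      ∀ x : Ext.{w} X Y n, ∃ c : Ext.{w} X (Wᘁ ⊗ (W ⊗ Y)) n,
        c.comp (Ext.mk₀ (counit W Y)) (add_zero n) = x := by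
  refine ⟨fun h x => ?_, fun h x => ?_⟩
  · obtain ⟨a, rfl⟩ := h x
    exact ⟨_, rfl⟩
  · obtain ⟨c, rfl⟩ := h x
    let ev : W ⊗ (Wᘁ ⊗ (W ⊗ Y)) ⟶ W ⊗ Y := (tensorDualAdj W).counit.app (W ⊗ Y)
    have hev : unit W (Wᘁ ⊗ (W ⊗ Y)) ≫ Wᘁ ◁ ev = 𝟙 _ := by
      rw [← tensorDualAdj_unit_app]
      exact (tensorDualAdj W).right_triangle_components (W ⊗ Y)
    let a : Ext (W ⊗ X) (W ⊗ Y) n :=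
      (c.mapExactFunctor (tensorLeft W)).comp (Ext.mk₀ ev) (add_zero n)
    have ha : (Ext.mk₀ (unit W X)).comp (a.mapExactFunctor (tensorLeft Wᘁ)) (zero_add n) = c :=
      calc
        _ = (Ext.mk₀ (unit W X)).comp
            (((c.mapExactFunctor (tensorLeft W)).mapExactFunctor (tensorLeft Wᘁ)).comp
              (Ext.mk₀ ((tensorLeft Wᘁ).map ev)) (add_zero n)) (zero_add n) := by
          rw [Ext.mapExactFunctor_comp, Ext.mapExactFunctor_mk₀]
        _ = (c.comp (Ext.mk₀ (unit W _)) (add_zero n)).comp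
              (Ext.mk₀ ((tensorLeft Wᘁ).map ev)) (add_zero n) := by
          rw [← Ext.comp_assoc_of_third_deg_zero, ext_unit_naturality W c]
        _ = c.comp (Ext.mk₀ (unit W _ ≫ Wᘁ ◁ ev)) (add_zero n) :=
          (Ext.comp_assoc_of_third_deg_zero _ _ _ _).trans
            (congrArg (fun e => c.comp e (add_zero n)) (Ext.mk₀_comp_mk₀ _ _))
        _ = c := by rw [hev, Ext.comp_mk₀_id]
    exact ⟨a, congrArg (fun e => Ext.comp e (Ext.mk₀ (counit W Y)) (add_zero n)) ha⟩

/-- Dimension shifting for the image of the transfer map, along a short exact sequence with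
projective middle term. -/
lemma ext_comp_counit_surjective_succ_iff {W Y : C} [Epi (counit W Y)] {S : ShortComplex C}
    (hS : S.ShortExact) [Projective S.X₂] {n : ℕ} :
    (∀ x : Ext.{w} S.X₃ Y (n + 1), ∃ c : Ext.{w} S.X₃ (Wᘁ ⊗ (W ⊗ Y)) (n + 1),
        c.comp (Ext.mk₀ (counit W Y)) (add_zero _) = x) ↔
      ∀ x : Ext.{w} S.X₁ Y n, ∃ c : Ext.{w} S.X₁ (Wᘁ ⊗ (W ⊗ Y)) n,
        c.comp (Ext.mk₀ (counit W Y)) (add_zero n) = x := by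
  refine ⟨fun h x => ?_, fun h x => ?_⟩
  · obtain ⟨c', hc'⟩ := h (hS.extClass.comp x (add_comm 1 n))
    obtain ⟨c, rfl⟩ : ∃ c, hS.extClass.comp c (add_comm 1 n) = c' :=
      Ext.contravariant_sequence_exact₃ hS _ c' (Ext.eq_zero_of_projective _) _
    obtain ⟨r, hr⟩ : ∃ r : Ext S.X₂ Y n, (Ext.mk₀ S.f).comp r (zero_add n) =
        x - c.comp (Ext.mk₀ (counit W Y)) (add_zero n) :=
      Ext.contravariant_sequence_exact₁ hS Y _ (add_comm 1 n) (by
        rw [sub_eq_add_neg, Ext.comp_add, Ext.comp_neg, ← hc',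
          Ext.comp_assoc_of_third_deg_zero, add_neg_cancel])
    -- classes on the projective object `S.X₂` come from the counit: they lift in degree zero and
    -- vanish in positive degrees
    obtain ⟨r', hr'⟩ : ∃ r' : Ext S.X₂ (Wᘁ ⊗ (W ⊗ Y)) n,
        r'.comp (Ext.mk₀ (counit W Y)) (add_zero n) = r := by
      cases n with
      | zero =>
        obtain ⟨f, rfl⟩ := (Ext.mk₀_bijective _ _).2 r
        exact ⟨Ext.mk₀ (Projective.factorThru f (counit W Y)), by simp⟩
      | succ n => exact ⟨0, by rw [Ext.eq_zero_of_projective r, Ext.zero_comp]⟩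
    refine ⟨c + (Ext.mk₀ S.f).comp r' (zero_add n), ?_⟩
    rw [Ext.add_comp, Ext.comp_assoc_of_third_deg_zero, hr', hr]
    abel
  · obtain ⟨y, rfl⟩ : ∃ y, hS.extClass.comp y (add_comm 1 n) = x :=
      Ext.contravariant_sequence_exact₃ hS Y x (Ext.eq_zero_of_projective _) _
    obtain ⟨c, rfl⟩ := h y
    exact ⟨hS.extClass.comp c (add_comm 1 n), Ext.comp_assoc_of_third_deg_zero _ _ _ _⟩

lemma ext_comp_counit_surjective_iff {V W : C} [∀ X : C, Projective (Vᘁ ⊗ (V ⊗ X))]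
    [∀ X : C, Epi (counit V X)] [∀ X : C, Epi (counit W X)] {X Y : C} {n : ℕ} :
    (∀ x : Ext.{w} X Y n, ∃ c : Ext.{w} X (Wᘁ ⊗ (W ⊗ Y)) n,
        c.comp (Ext.mk₀ (counit W Y)) (add_zero n) = x) ↔
      StableHomZero W ((omega V).obj^[n] X) Y := by
  induction n generalizing X with
  | zero =>
    refine ⟨fun h f => ?_, fun h x => ?_⟩
    · obtain ⟨c, hc⟩ := h (Ext.mk₀ f)
      obtain ⟨a, rfl⟩ := (Ext.mk₀_bijective _ _).2 c
      rw [Ext.mk₀_comp_mk₀] at hc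
      rw [← (Ext.mk₀_bijective _ _).1 hc]
      exact factorsThroughProjective_comp_counit a
    · obtain ⟨f, rfl⟩ := (Ext.mk₀_bijective _ _).2 x
      obtain ⟨a, rfl⟩ := (h f).exists_comp_counit
      exact ⟨Ext.mk₀ a, Ext.mk₀_comp_mk₀ _ _⟩
  | succ n ih =>
    let S : ShortComplex C := ShortComplex.mk (kernel.ι (counit V X)) (counit V X) (by simp)
    have hS : S.ShortExact :=
      { exact := ShortComplex.exact_of_f_is_kernel _ (kernelIsKernel _) }
    have : Projective S.X₂ := inferInstanceAs (Projective (Vᘁ ⊗ (V ⊗ X)))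
    exact (ext_comp_counit_surjective_succ_iff hS).trans ih

/-- If `V* ⊗ V ⊗ -` takes projective values and surjects onto the identity, so that `Ω_V` computes
syzygies, then virtual `W`-projectivity is the eventual vanishing of stable maps out of the iterated
translates `Ω_Vⁿ X`. -/
theorem isVirtuallyProjective_iff (V : C) {W : C} [∀ X : C, Projective (Vᘁ ⊗ (V ⊗ X))]
    [∀ X : C, Epi (counit V X)] [∀ X : C, Epi (counit W X)] (X : C) :
    IsVirtuallyProjective.{w} W X ↔
      eventuallyZero (stableOmega W V) ((toStable W).obj X) := by
  have : EnoughProjectives C := ⟨fun X => ⟨{ p := Vᘁ ⊗ (V ⊗ X), f := counit V X }⟩⟩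
  simp only [IsVirtuallyProjective, eventuallyZero_stableOmega_iff, surjective_transfer_iff,
    ext_comp_counit_surjective_iff (V := V)]

end Transfer

/-! ### Nonzero objects over a simple tensor unit -/

section Simple

variable {C : Type u} [Category.{v} C] [Abelian C] [MonoidalCategory C] [MonoidalPreadditive C]
  [SymmetricCategory C] [RightRigidCategory C]

lemma coevaluation_ne_zero {W : C} (hW : ¬ IsZero W) : η_ W Wᘁ ≠ 0 := fun h => hW <| by
  have h' := ExactPairing.evaluation_coevaluation W Wᘁ
  rw [h, MonoidalPreadditive.zero_whiskerRight, zero_comp] at h'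
  rw [IsZero.iff_id_eq_zero, ← cancel_epi (λ_ W).hom, comp_zero, Category.comp_id,
    ← cancel_mono (ρ_ W).inv, ← h', zero_comp]

lemma evaluation_ne_zero {W : C} (hW : ¬ IsZero W) : ε_ W Wᘁ ≠ 0 := fun h => hW <| by
  have h' := ExactPairing.evaluation_coevaluation W Wᘁ
  rw [h, MonoidalPreadditive.whiskerLeft_zero, comp_zero, comp_zero] at h'
  rw [IsZero.iff_id_eq_zero, ← cancel_epi (λ_ W).hom, comp_zero, Category.comp_id,
    ← cancel_mono (ρ_ W).inv, ← h', zero_comp]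

lemma mono_unit [Simple (𝟙_ C)] {W : C} (hW : ¬ IsZero W) (X : C) : Mono (unit W X) := by
  have := mono_of_nonzero_from_simple (coevaluation_ne_zero hW)
  have : Mono ((η_ W Wᘁ ≫ (β_ W Wᘁ).hom) ▷ X) :=
    inferInstanceAs (Mono ((tensorRight X).map (η_ W Wᘁ ≫ (β_ W Wᘁ).hom)))
  unfold unit
  infer_instance

lemma epi_counit [Simple (𝟙_ C)] {W : C} (hW : ¬ IsZero W) (X : C) : Epi (counit W X) := by
  have := epi_of_nonzero_to_simple (evaluation_ne_zero hW)
  have : Epi (ε_ W Wᘁ ▷ X) := inferInstanceAs (Epi ((tensorRight X).map (ε_ W Wᘁ)))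
  unfold counit
  infer_instance

lemma projective_tensor (X P : C) [hP : Projective P] : Projective (X ⊗ P) :=
  (tensorDualAdj X).map_projective P hP

end Simple

/-! ### Representations of a finite group -/

section FDRep

variable (k G : Type u) [Field k] [Group G] [Finite G]

instance simple_tensorUnit_fdRep : Simple (𝟙_ (FDRep k G)) where
  mono_isIso_iff_nonzero {Y} f _ := by
    let F := Action.forget (FGModuleCat k) G ⋙ forget₂ (FGModuleCat k) (ModuleCat k)
    have : Simple (F.obj (𝟙_ (FDRep k G))) :=
      inferInstanceAs (Simple (ModuleCat.of k k))
    rw [← isIso_iff_of_reflects_iso f F, Simple.mono_isIso_iff_nonzero (F.map f), Ne, Ne,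
      F.map_eq_zero_iff]

instance projective_regular : Projective (regular k G) :=
  Functor.projective_of_map_projective (forget₂ (FDRep k G) (Rep k G))
    (inferInstanceAs (Projective (Rep.leftRegular k G)))

lemma not_isZero_regular : ¬ IsZero (regular k G) := fun h => by
  have h' : IsZero (ModuleCat.of k (MonoidAlgebra k G)) :=
    (Action.forget (FGModuleCat k) G ⋙ forget₂ (FGModuleCat k) (ModuleCat k)).map_isZero h
  exact not_subsingleton (MonoidAlgebra k G) (ModuleCat.subsingleton_of_isZero h')

instance projective_regular_tensor (X : FDRep k G) :
    Projective ((regular k G)ᘁ ⊗ (regular k G ⊗ X)) :=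
  have := projective_tensor X (regular k G)
  have := Projective.of_iso (β_ X (regular k G)) this
  projective_tensor _ _

end FDRep

end RelStable

end

theorem mainTheorem10 {k G : Type u} [Field k] [Group G] [Finite G]
    (W : FDRep k G) (hW : ¬ IsZero W) :
    (∀ X : FDRep k G, RelStable.IsVirtuallyProjective.{u + 1} W X ↔
      RelStable.eventuallyZero (RelStable.stableOmega W (RelStable.regular k G))
        ((RelStable.toStable W).obj X)) ∧
    RelStable.IsThick
      (fun X : RelStable.StableCat W => RelStable.IsVirtuallyProjective.{u + 1} W X.as) ∧
    (∀ V : FDRep k G, RelStable.IsRelProjective W V →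
      RelStable.IsThick (RelStable.eventuallyZero (RelStable.stableOmega W V))) := by
  have hm := RelStable.mono_unit hW
  have he := RelStable.epi_counit hW
  have hr := RelStable.epi_counit (RelStable.not_isZero_regular k G)
  have h := RelStable.isVirtuallyProjective_iff.{u + 1} (RelStable.regular k G) (W := W)
  refine ⟨h, ?_, fun V _ => RelStable.isThick_eventuallyZero W V⟩
  have heq : (fun X : RelStable.StableCat W => RelStable.IsVirtuallyProjective.{u + 1} W X.as) =
      RelStable.eventuallyZero (RelStable.stableOmega W (RelStable.regular k G)) :=
    funext fun X => propext (h X.as)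
  rw [heq]
  exact RelStable.isThick_eventuallyZero W _
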